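/- Let $n \ge 0$ and let $K \subseteq \mathbb{R}^n$ be a convex body (compact, convex, with non-empty interior) with $C^2$-boundary, i.e., there is $\Psi \in C^2(\mathbb{R}^n,\mathbb{R})$ with $$K = \{x : \Psi(x) \le 0\}, \qquad \partial K = \{x : \Psi(x) = 0\}, \qquad \nabla\Psi(a) \neq 0 \text{ for all } a \in \partial K. \tag{$*$}$$ A (inward) normal of $K$ at $a \in \partial K$ is a vector $v$ with $\langle v, y - a\rangle \ge 0$ for all $y \in K$, and $T_aK$ denotes the linear tangent space, i.e., the set of all $x \in \mathbb{R}^n$ with $\langle v, x\rangle = 0$ for every normal $v$ of $K$ at $a$. The body $K$ is called *ball-like* if it has a unique inward unit normal at every boundary point and there are $\epsilon_{insc}, \epsilon_{circ} > 0$ such that for every $x \in \partial K$ there is a closed ball $B_{insc}$ of radius $\epsilon_{insc}$ with $x \in \partial B_{insc}$ and $B_{insc} \subseteq K$, and a closed ball $B_{circ}$ of radius $\epsilon_{circ}$ with $x \in \partial B_{circ}$ and $K \subseteq B_{circ}$. The body $K$ is called *2-strictly convex* if, for some $\Psi \in C^2(\mathbb{R}^n,\mathbb{R})$ satisfying $(*)$,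 $$x^T \nabla^2\Psi(a)\, x > 0 \quad \text{for all } a \in \partial K \text{ and all } x \in T_aK\setminus\{0\}. \tag{$**$}$$ Then $K$ is ball-like if and only if it is 2-strictly convex. Moreover, 2-strict convexity does not depend on the choice of the defining function: for every $\Psi \in C^2(\mathbb{R}^n,\mathbb{R})$ satisfying $(*)$, $K$ is 2-strictly convex if and only if $\Psi$ satisfies $(**)$. -/

import Mathlib

open Set Metric

/-- The (inward) normal cone of a set `K` at `a`. -/
def normalCone {n : ℕ} (K : Set (EuclideanSpace ℝ (Fin n))) (a : EuclideanSpace ℝ (Fin n)) :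
    Set (EuclideanSpace ℝ (Fin n)) :=
  {v | ∀ x ∈ K, 0 ≤ inner ℝ v (x - a)}

/-- `K` is smooth if it has a unique (inward) unit normal at each boundary point. -/
def IsSmoothBody {n : ℕ} (K : Set (EuclideanSpace ℝ (Fin n))) : Prop :=
  ∀ a ∈ frontier K, ∃! v : EuclideanSpace ℝ (Fin n), ‖v‖ = 1 ∧ v ∈ normalCone K a

/-- The linear tangent space of `K` at `a`: the directions orthogonal to all normals of `K` at `a`.
If `K` has a unique unit normal `v` at `a`, this is the hyperplane `{x | ⟪v, x⟫ = 0}`. -/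
def bodyTangentSpace {n : ℕ} (K : Set (EuclideanSpace ℝ (Fin n)))
    (a : EuclideanSpace ℝ (Fin n)) : Set (EuclideanSpace ℝ (Fin n)) :=
  {x | ∀ v ∈ normalCone K a, inner ℝ v x = 0}

/-- `K` has an inscribed tangent ball of radius `ε` at `x`. -/
def HasInscribedTangentBall {n : ℕ} (K : Set (EuclideanSpace ℝ (Fin n))) (ε : ℝ)
    (x : EuclideanSpace ℝ (Fin n)) : Prop :=
  ∃ c : EuclideanSpace ℝ (Fin n), x ∈ frontier (closedBall c ε) ∧ closedBall c ε ⊆ K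

/-- `K` has a circumscribed tangent ball of radius `ε` at `x`. -/
def HasCircumscribedTangentBall {n : ℕ} (K : Set (EuclideanSpace ℝ (Fin n))) (ε : ℝ)
    (x : EuclideanSpace ℝ (Fin n)) : Prop :=
  ∃ c : EuclideanSpace ℝ (Fin n), x ∈ frontier (closedBall c ε) ∧ K ⊆ closedBall c ε

/-- `K` is ball-like: it is smooth, and it has inscribed and circumscribed tangent balls of
uniform positive radii at all its boundary points. -/
def IsBallLike {n : ℕ} (K : Set (EuclideanSpace ℝ (Fin n))) : Prop :=
  IsSmoothBody K ∧ ∃ εinsc > 0, ∃ εcirc > 0, ∀ x ∈ frontier K,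
    HasInscribedTangentBall K εinsc x ∧ HasCircumscribedTangentBall K εcirc x

/-- `Ψ` is a `C²` defining function of `K`, with nonvanishing gradient on the boundary. -/
structure IsC2DefiningFunction {n : ℕ} (K : Set (EuclideanSpace ℝ (Fin n)))
    (Ψ : EuclideanSpace ℝ (Fin n) → ℝ) : Prop where
  contDiff : ContDiff ℝ 2 Ψ
  eq_sublevel : K = {x | Ψ x ≤ 0}
  frontier_eq : frontier K = {x | Ψ x = 0}
  gradient_ne_zero : ∀ a ∈ frontier K, gradient Ψ a ≠ 0

/-- `K` has a `C²` boundary. The defining function is not required to be convex: a convex one has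
automatically a nonvanishing gradient on the boundary of a set with nonempty interior, so that
asking for a convex `C²` defining function would be a (formally) stronger requirement. -/
def HasC2Boundary {n : ℕ} (K : Set (EuclideanSpace ℝ (Fin n))) : Prop :=
  ∃ Ψ : EuclideanSpace ℝ (Fin n) → ℝ, IsC2DefiningFunction K Ψ

/-- The Hessian of `Ψ` is positive definite on the tangent space of `K` at each boundary point. -/
def HessianPosDefOnTangent {n : ℕ} (K : Set (EuclideanSpace ℝ (Fin n)))
    (Ψ : EuclideanSpace ℝ (Fin n) → ℝ) : Prop :=
  ∀ a ∈ frontier K, ∀ x ∈ bodyTangentSpace K a, x ≠ 0 → 0 < fderiv ℝ (fderiv ℝ Ψ) a x x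

/-- `K` is 2-strictly convex. -/
def IsTwoStrictlyConvex {n : ℕ} (K : Set (EuclideanSpace ℝ (Fin n))) : Prop :=
  ∃ Ψ : EuclideanSpace ℝ (Fin n) → ℝ, IsC2DefiningFunction K Ψ ∧ HessianPosDefOnTangent K Ψ

/-! Being ball-like does not mention `Ψ`, so it suffices to link it to each defining function
separately. If one `Ψ` has positive Hessian on tangent spaces, `K` is ball-like (`isBallLike`):
inscribed balls come from bounds on the gradient and Hessian alone, while circumscribed balls come
from a compactness argument (`exists_mul_norm_sq_le`) giving uniform quadratic separation from the
supporting hyperplanes. Conversely (`hessianPosDefOnTangent`), a circumscribed ball makes `K` curve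
away from its tangent plane quadratically. If the Hessian of some defining function were nonpositive
in a tangent direction, a parabola with too little curvature would stay in `K` and leave the ball.
-/

open Filter Topology

/-! ### Second-order Taylor expansions. -/

section Taylor

variable {E : Type*} [NormedAddCommGroup E] [NormedSpace ℝ E]

/-- Second order Taylor formula with Lagrange remainder along a segment. -/
theorem ContDiff.exists_taylor_two {f : E → ℝ} (hf : ContDiff ℝ 2 f) (a v : E) :
    ∃ ξ ∈ Set.Ioo (0 : ℝ) 1,
      f (a + v) = f a + fderiv ℝ f a v + fderiv ℝ (fderiv ℝ f) (a + ξ • v) v v / 2 := by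
  have hf1 : Differentiable ℝ f := hf.differentiable (by norm_num)
  have hf2 : Differentiable ℝ (fderiv ℝ f) :=
    (hf.fderiv_right (m := 1) (by norm_num)).differentiable (by norm_num)
  have hl : ∀ t : ℝ, HasDerivAt (fun t : ℝ => a + t • v) v t := fun t => by
    simpa using ((hasDerivAt_id t).smul_const v).const_add a
  have h1 : ∀ t : ℝ, HasDerivAt (fun t : ℝ => f (a + t • v)) (fderiv ℝ f (a + t • v) v) t :=
    fun t => (hf1 _).hasFDerivAt.comp_hasDerivAt t (hl t)
  have h2 : ∀ t : ℝ, HasDerivAt (fun t : ℝ => fderiv ℝ f (a + t • v) v)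
      (fderiv ℝ (fderiv ℝ f) (a + t • v) v v) t := fun t => by
    simpa using ((hf2 _).hasFDerivAt.comp_hasDerivAt t (hl t)).clm_apply (hasDerivAt_const t v)
  set c : ℝ := f (a + v) - f a - fderiv ℝ f a v with hc
  -- By the choice of `c`, this function equals `f (a + v)` at both `t = 0` and `t = 1`, so Rolle
  -- applies; `1 - t` factors out of its derivative.
  have h3 : ∀ t : ℝ, HasDerivAt
      (fun t : ℝ => f (a + t • v) + (1 - t) * fderiv ℝ f (a + t • v) v + (1 - t) ^ 2 * c)
      ((1 - t) * (fderiv ℝ (fderiv ℝ f) (a + t • v) v v - 2 * c)) t := fun t => by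
    have hs : HasDerivAt (fun t : ℝ => 1 - t) (-1) t := by
      simpa using (hasDerivAt_id t).const_sub 1
    refine (((h1 t).add (hs.mul (h2 t))).add ((hs.pow 2).mul_const c)).congr_deriv ?_
    norm_num
    ring
  obtain ⟨ξ, hξ, h⟩ := exists_hasDerivAt_eq_zero (zero_lt_one (α := ℝ))
    (fun t _ => (h3 t).continuousAt.continuousWithinAt) (by simp [hc]) (fun t _ => h3 t)
  refine ⟨ξ, hξ, ?_⟩
  have := (mul_eq_zero.1 h).resolve_left (sub_pos.2 hξ.2).ne'
  linarith

theorem Continuous.tendsto_apply_apply {F : E → E →L[ℝ] E →L[ℝ] ℝ} (hF : Continuous F)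
    {α : Type*} {l : Filter α} {p w : α → E} {a x : E} (hp : Tendsto p l (𝓝 a))
    (hw : Tendsto w l (𝓝 x)) : Tendsto (fun k => F (p k) (w k) (w k)) l (𝓝 (F a x x)) := by
  have h : Continuous fun z : E × E => F z.1 z.2 z.2 :=
    ((hF.comp continuous_fst).clm_apply continuous_snd).clm_apply continuous_snd
  exact (h.tendsto (a, x)).comp (hp.prodMk_nhds hw)

/-- Second order Taylor expansion along convergent base points and directions. -/
theorem ContDiff.exists_taylor_two_tendsto {f : E → ℝ} (hf : ContDiff ℝ 2 f)
    {α : Type*} {l : Filter α} {p w : α → E} {t : α → ℝ} {a x : E}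
    (hp : Tendsto p l (𝓝 a)) (hw : Tendsto w l (𝓝 x)) (ht : Tendsto t l (𝓝 0)) :
    ∃ q : α → ℝ, Tendsto q l (𝓝 (fderiv ℝ (fderiv ℝ f) a x x)) ∧
      ∀ k, f (p k + t k • w k) = f (p k) + t k * fderiv ℝ f (p k) (w k) + t k ^ 2 * q k / 2 := by
  choose ξ hξ h using fun k => hf.exists_taylor_two (p k) (t k • w k)
  have hcont : Continuous (fderiv ℝ (fderiv ℝ f)) :=
    (hf.fderiv_right (m := 1) (by norm_num)).continuous_fderiv (by norm_num)
  refine ⟨fun k => fderiv ℝ (fderiv ℝ f) (p k + ξ k • t k • w k) (w k) (w k), ?_, fun k => ?_⟩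
  · have h1 : Tendsto (fun k => ξ k * t k) l (𝓝 0) :=
      squeeze_zero_norm (a := fun k => ‖t k‖) (fun k => by
        rw [norm_mul, Real.norm_of_nonneg (hξ k).1.le]
        exact mul_le_of_le_one_left (norm_nonneg _) (hξ k).2.le) (by simpa using ht.norm)
    have h2 : Tendsto (fun k => p k + ξ k • t k • w k) l (𝓝 a) := by
      simpa [smul_smul] using hp.add (h1.smul hw)
    exact hcont.tendsto_apply_apply h2 hw
  · rw [h k]
    simp only [map_smul, smul_eq_mul, smul_apply]
    ring

end Taylor

/-! ### Convex bodies with a defining function: normals, tangent balls, curvature. -/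

section Body

variable {n : ℕ}

theorem inner_gradient_eq_fderiv (Ψ : EuclideanSpace ℝ (Fin n) → ℝ)
    (a x : EuclideanSpace ℝ (Fin n)) :
    inner ℝ (gradient Ψ a) x = fderiv ℝ Ψ a x := by
  simp [gradient]

/-- Expanding the square around the contact point `a` turns both ball conditions into quadratic
bounds on the component along the outward normal `u`. -/
theorem mem_closedBall_sub_smul_iff {a u x : EuclideanSpace ℝ (Fin n)} {r : ℝ} (hr : 0 < r)
    (hu : ‖u‖ = 1) :
    x ∈ closedBall (a - r • u) r ↔ ‖x - a‖ ^ 2 + 2 * r * inner ℝ u (x - a) ≤ 0 := by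
  have h : ‖x - (a - r • u)‖ ^ 2 = ‖x - a‖ ^ 2 + 2 * r * inner ℝ u (x - a) + r ^ 2 := by
    rw [show x - (a - r • u) = (x - a) + r • u by abel, norm_add_sq_real, inner_smul_right,
      norm_smul, hu, real_inner_comm, Real.norm_of_nonneg hr.le]
    ring
  rw [mem_closedBall, dist_eq_norm, ← sq_le_sq₀ (norm_nonneg _) hr.le, h]
  constructor <;> intro <;> linarith

theorem mem_frontier_closedBall_sub_smul {a u : EuclideanSpace ℝ (Fin n)} {r : ℝ} (hr : 0 < r)
    (hu : ‖u‖ = 1) : a ∈ frontier (closedBall (a - r • u) r) := by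
  rw [frontier_closedBall _ hr.ne']
  simp [norm_smul, hu, hr.le]

namespace IsC2DefiningFunction

variable {K : Set (EuclideanSpace ℝ (Fin n))} {Ψ : EuclideanSpace ℝ (Fin n) → ℝ}
  {a : EuclideanSpace ℝ (Fin n)}

theorem continuous_gradient (h : IsC2DefiningFunction K Ψ) : Continuous (gradient Ψ) :=
  (InnerProductSpace.toDual ℝ _).symm.continuous.comp (h.contDiff.continuous_fderiv (by norm_num))

theorem isClosed (h : IsC2DefiningFunction K Ψ) : IsClosed K := by
  rw [h.eq_sublevel]
  exact isClosed_le h.contDiff.continuous continuous_const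

theorem apply_eq_zero (h : IsC2DefiningFunction K Ψ) (ha : a ∈ frontier K) : Ψ a = 0 := by
  rwa [h.frontier_eq] at ha

theorem mem_iff (h : IsC2DefiningFunction K Ψ) {x : EuclideanSpace ℝ (Fin n)} :
    x ∈ K ↔ Ψ x ≤ 0 := by
  conv_lhs => rw [h.eq_sublevel]
  rfl

theorem mem_of_mem_frontier (h : IsC2DefiningFunction K Ψ) (ha : a ∈ frontier K) : a ∈ K :=
  h.mem_iff.2 (h.apply_eq_zero ha).le

theorem hasDerivAt_line (h : IsC2DefiningFunction K Ψ) (a y : EuclideanSpace ℝ (Fin n)) :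
    HasDerivAt (fun t : ℝ => Ψ (a + t • y)) (inner ℝ (gradient Ψ a) y) 0 := by
  rw [inner_gradient_eq_fderiv]
  have hd : HasFDerivAt Ψ (fderiv ℝ Ψ a) (a + (0 : ℝ) • y) := by
    simpa using (h.contDiff.differentiable (by norm_num) a).hasFDerivAt
  have hl : HasDerivAt (fun t : ℝ => a + t • y) y 0 := by
    simpa using ((hasDerivAt_id (0 : ℝ)).smul_const y).const_add a
  exact hd.comp_hasDerivAt 0 hl

/-- The gradient is an outward normal of a convex body. -/
theorem inner_gradient_nonpos (h : IsC2DefiningFunction K Ψ) (hK : Convex ℝ K)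
    (ha : a ∈ frontier K) {y : EuclideanSpace ℝ (Fin n)} (hy : y ∈ K) :
    inner ℝ (gradient Ψ a) (y - a) ≤ 0 := by
  by_contra! hpos
  have hlt := (h.hasDerivAt_line a (y - a)).tendsto_slope_zero_right.eventually
    (lt_mem_nhds hpos)
  obtain ⟨t, ht, ht0, ht1⟩ :=
    (hlt.and (Ioo_mem_nhdsGT (zero_lt_one (α := ℝ)))).exists
  have hmem : a + t • (y - a) ∈ K :=
    hK.add_smul_sub_mem (h.mem_of_mem_frontier ha) hy ⟨ht0.le, ht1.le⟩
  simp only [zero_add, zero_smul, add_zero, h.apply_eq_zero ha, sub_zero, smul_eq_mul] at ht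
  have := h.mem_iff.1 hmem
  have := mul_nonpos_of_nonneg_of_nonpos (inv_nonneg.2 ht0.le) this
  linarith

/-- Every normal at a boundary point is a nonnegative multiple of the negative gradient. -/
theorem exists_eq_smul_of_mem_normalCone (h : IsC2DefiningFunction K Ψ) (ha : a ∈ frontier K)
    {v : EuclideanSpace ℝ (Fin n)} (hv : v ∈ normalCone K a) :
    ∃ c : ℝ, 0 ≤ c ∧ v = -(c • gradient Ψ a) := by
  set g := gradient Ψ a with hg
  have hg0 : 0 < ‖g‖ := norm_pos_iff.2 (h.gradient_ne_zero a ha)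
  -- `Ψ` decreases initially along `y`, so a short move stays in `K`; `key'` passes to the closed
  -- half-space by tilting `y` towards `-g`.
  have key : ∀ y, inner ℝ g y < 0 → 0 ≤ inner ℝ v y := fun y hy => by
    have hlt := (h.hasDerivAt_line a y).tendsto_slope_zero_right.eventually (gt_mem_nhds hy)
    obtain ⟨t, ht, ht0⟩ := (hlt.and self_mem_nhdsWithin).exists
    replace ht0 : 0 < t := ht0
    simp only [zero_add, zero_smul, add_zero, h.apply_eq_zero ha, sub_zero, smul_eq_mul] at ht
    have hneg : Ψ (a + t • y) < 0 := by
      by_contra! hc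
      exact absurd ht (not_lt.2 (mul_nonneg (inv_nonneg.2 ht0.le) hc))
    have := hv _ (h.mem_iff.2 hneg.le)
    rw [add_sub_cancel_left, inner_smul_right] at this
    exact nonneg_of_mul_nonneg_right this ht0
  have key' : ∀ y, inner ℝ g y ≤ 0 → 0 ≤ inner ℝ v y := fun y hy => by
    have hlim : Tendsto (fun s : ℝ => inner ℝ v (y - s • g)) (𝓝[>] 0) (𝓝 (inner ℝ v y)) := by
      have : Continuous fun s : ℝ => inner ℝ v (y - s • g) := by fun_prop
      simpa using (this.tendsto 0).mono_left nhdsWithin_le_nhds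
    refine ge_of_tendsto hlim (eventually_nhdsWithin_of_forall fun s hs => key _ ?_)
    rw [inner_sub_right, inner_smul_right, real_inner_self_eq_norm_sq]
    have := mul_pos (show 0 < s from hs) (pow_pos hg0 2)
    linarith
  -- This makes `v + c • g` orthogonal to `g`; testing `key'` on its negative forces it to vanish.
  set c : ℝ := -(inner ℝ v g / ‖g‖ ^ 2) with hc
  refine ⟨c, ?_, ?_⟩
  · have := key' (-g) (by rw [inner_neg_right, real_inner_self_eq_norm_sq]; nlinarith)
    rw [inner_neg_right] at this
    rw [hc, ← neg_div]
    positivity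
  · have horth : inner ℝ g (v + c • g) = 0 := by
      rw [inner_add_right, inner_smul_right, real_inner_self_eq_norm_sq, hc, real_inner_comm]
      field_simp
      ring
    have h1 : 0 ≤ inner ℝ v (-(v + c • g)) := key' _ (by rw [inner_neg_right, horth]; simp)
    have h2 : inner ℝ (v + c • g) (v + c • g) ≤ 0 := by
      rw [inner_add_left, inner_smul_left, horth, mul_zero, add_zero]
      rw [inner_neg_right] at h1
      linarith
    exact eq_neg_of_add_eq_zero_left ((real_inner_self_nonpos).1 h2)

theorem neg_gradient_mem_normalCone (h : IsC2DefiningFunction K Ψ) (hK : Convex ℝ K)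
    (ha : a ∈ frontier K) : -gradient Ψ a ∈ normalCone K a := fun y hy => by
  rw [inner_neg_left]
  exact neg_nonneg.2 (h.inner_gradient_nonpos hK ha hy)

theorem isSmoothBody (h : IsC2DefiningFunction K Ψ) (hK : Convex ℝ K) : IsSmoothBody K := by
  intro a ha
  have hg0 : 0 < ‖gradient Ψ a‖ := norm_pos_iff.2 (h.gradient_ne_zero a ha)
  refine ⟨‖gradient Ψ a‖⁻¹ • -gradient Ψ a, ⟨?_, fun y hy => ?_⟩, ?_⟩
  · rw [norm_smul, norm_neg, norm_inv, norm_norm, inv_mul_cancel₀ hg0.ne']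
  · rw [inner_smul_left]
    exact mul_nonneg (by simp) (h.neg_gradient_mem_normalCone hK ha y hy)
  · rintro v ⟨hv1, hv⟩
    obtain ⟨c, hc, rfl⟩ := h.exists_eq_smul_of_mem_normalCone ha hv
    rw [norm_neg, norm_smul, Real.norm_of_nonneg hc] at hv1
    rw [eq_inv_of_mul_eq_one_left hv1, smul_neg]

theorem mem_bodyTangentSpace_iff (h : IsC2DefiningFunction K Ψ) (hK : Convex ℝ K)
    (ha : a ∈ frontier K) {x : EuclideanSpace ℝ (Fin n)} :
    x ∈ bodyTangentSpace K a ↔ inner ℝ (gradient Ψ a) x = 0 := by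
  constructor
  · intro hx
    simpa using hx _ (h.neg_gradient_mem_normalCone hK ha)
  · intro hx v hv
    obtain ⟨c, -, rfl⟩ := h.exists_eq_smul_of_mem_normalCone ha hv
    rw [inner_neg_left, inner_smul_left, hx, mul_zero, neg_zero]

theorem exists_pos_le_norm_gradient (h : IsC2DefiningFunction K Ψ) (hK : IsCompact K) :
    ∃ m > 0, ∀ a ∈ frontier K, m ≤ ‖gradient Ψ a‖ :=
  (hK.of_isClosed_subset isClosed_frontier h.isClosed.frontier_subset).exists_forall_le'
    h.continuous_gradient.norm.continuousOn fun a ha => norm_pos_iff.2 (h.gradient_ne_zero a ha)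

/-- A body with a `C²` defining function has inscribed tangent balls of a uniform radius. -/
theorem exists_hasInscribedTangentBall (h : IsC2DefiningFunction K Ψ) (hK : IsCompact K) :
    ∃ ε > 0, ∀ a ∈ frontier K, HasInscribedTangentBall K ε a := by
  obtain ⟨m, hm, hmle⟩ := h.exists_pos_le_norm_gradient hK
  obtain ⟨R, hR⟩ := hK.isBounded.subset_closedBall (0 : EuclideanSpace ℝ (Fin n))
  have hcont : Continuous (fderiv ℝ (fderiv ℝ Ψ)) :=
    (h.contDiff.fderiv_right (m := 1) (by norm_num)).continuous_fderiv (by norm_num)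
  obtain ⟨M, hM⟩ :=
    (isCompact_closedBall (0 : EuclideanSpace ℝ (Fin n)) (R + 2)).exists_bound_of_continuousOn
      (f := fderiv ℝ (fderiv ℝ Ψ)) hcont.continuousOn
  -- Taking `L ≥ m` gives a radius `m / L ≤ 1`, so the ball stays where `M` bounds the Hessian.
  set L : ℝ := max M m with hL
  have hL0 : 0 < L := hm.trans_le (le_max_right _ _)
  have hr : 0 < m / L := div_pos hm hL0
  refine ⟨m / L, hr, fun a ha => ?_⟩
  have hg0 : 0 < ‖gradient Ψ a‖ := norm_pos_iff.2 (h.gradient_ne_zero a ha)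
  set u := ‖gradient Ψ a‖⁻¹ • gradient Ψ a with hu
  have hu1 : ‖u‖ = 1 := by rw [hu, norm_smul, norm_inv, norm_norm, inv_mul_cancel₀ hg0.ne']
  refine ⟨a - (m / L) • u, mem_frontier_closedBall_sub_smul hr hu1, fun x hx => h.mem_iff.2 ?_⟩
  have hx1 := (mem_closedBall_sub_smul_iff hr hu1).1 hx
  have hxa : ‖x - a‖ ≤ 2 := by
    have h1 : m / L ≤ 1 := (div_le_one hL0).2 (le_max_right _ _)
    have h2 : dist x a ≤ m / L + m / L := (dist_triangle_right _ _ _).trans (add_le_add hx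
      (isClosed_closedBall.frontier_subset (mem_frontier_closedBall_sub_smul hr hu1)))
    rw [← dist_eq_norm]
    linarith
  obtain ⟨ξ, hξ, hT⟩ := h.contDiff.exists_taylor_two a (x - a)
  rw [add_sub_cancel, h.apply_eq_zero ha, zero_add, ← inner_gradient_eq_fderiv] at hT
  have hmem : a + ξ • (x - a) ∈ closedBall (0 : EuclideanSpace ℝ (Fin n)) (R + 2) := by
    rw [mem_closedBall_zero_iff]
    refine (norm_add_le _ _).trans (add_le_add
      (mem_closedBall_zero_iff.1 (hR (h.mem_of_mem_frontier ha))) ?_)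
    rw [norm_smul, Real.norm_of_nonneg hξ.1.le]
    exact (mul_le_of_le_one_left (norm_nonneg _) hξ.2.le).trans hxa
  have hH : fderiv ℝ (fderiv ℝ Ψ) (a + ξ • (x - a)) (x - a) (x - a) ≤ L * ‖x - a‖ ^ 2 := by
    refine (le_abs_self _).trans ((ContinuousLinearMap.le_opNorm₂
      (fderiv ℝ (fderiv ℝ Ψ) (a + ξ • (x - a))) (x - a) (x - a)).trans ?_)
    rw [mul_assoc, ← sq]
    exact mul_le_mul_of_nonneg_right ((hM _ hmem).trans (le_max_left _ _)) (sq_nonneg _)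
  have hin : inner ℝ (gradient Ψ a) (x - a) = ‖gradient Ψ a‖ * inner ℝ u (x - a) := by
    rw [hu, inner_smul_left]
    simp [hg0.ne']
  have hLm : L * ‖x - a‖ ^ 2 + 2 * m * inner ℝ u (x - a) ≤ 0 := by
    have := mul_nonpos_of_nonneg_of_nonpos hL0.le hx1
    calc _ = L * (‖x - a‖ ^ 2 + 2 * (m / L) * inner ℝ u (x - a)) := by field_simp
      _ ≤ 0 := this
  have hneg : inner ℝ u (x - a) ≤ 0 := by
    by_contra! hc
    have := mul_pos hm hc
    have := mul_nonneg hL0.le (sq_nonneg ‖x - a‖)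
    linarith
  have := mul_le_mul_of_nonpos_right (hmle a ha) hneg
  rw [hT, hin]
  linarith

/-- Positivity of the Hessian on tangent spaces gives a uniform quadratic separation from the
supporting hyperplanes. -/
theorem exists_mul_norm_sq_le (h : IsC2DefiningFunction K Ψ) (hK : IsCompact K)
    (hconv : Convex ℝ K) (hpos : HessianPosDefOnTangent K Ψ) :
    ∃ c > 0, ∀ a ∈ frontier K, ∀ y ∈ K,
      c * ‖y - a‖ ^ 2 ≤ -inner ℝ (gradient Ψ a) (y - a) := by
  by_contra! hcon
  have ht : ∀ k : ℕ, (0 : ℝ) < 1 / ((k : ℝ) + 1) := fun k => Nat.one_div_pos_of_nat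
  -- The constant is a square because one factor `1 / (k + 1)` is spent pulling `y k` towards `p k`,
  -- where Taylor is local; the other makes the limiting Hessian value nonpositive.
  choose p hp y hy hlt using fun k : ℕ => hcon ((1 / ((k : ℝ) + 1)) ^ 2) (pow_pos (ht k) 2)
  have hne : ∀ k, 0 < ‖y k - p k‖ := fun k => by
    rw [norm_pos_iff]
    intro h0
    simpa [h0] using hlt k
  set w : ℕ → EuclideanSpace ℝ (Fin n) := fun k => ‖y k - p k‖⁻¹ • (y k - p k) with hw
  have hyw : ∀ k, y k - p k = ‖y k - p k‖ • w k := fun k => by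
    rw [hw, smul_smul, mul_inv_cancel₀ (hne k).ne', one_smul]
  have hw1 : ∀ k, w k ∈ sphere (0 : EuclideanSpace ℝ (Fin n)) 1 := fun k => by
    rw [mem_sphere_zero_iff_norm, hw, norm_smul, norm_inv, norm_norm, inv_mul_cancel₀ (hne k).ne']
  obtain ⟨⟨a, x⟩, ⟨ha, hx⟩, φ, hφ, hlim⟩ :=
    ((hK.of_isClosed_subset isClosed_frontier h.isClosed.frontier_subset).prod
      (isCompact_sphere (0 : EuclideanSpace ℝ (Fin n)) 1)).tendsto_subseq
      (x := fun k => (p k, w k)) fun k => ⟨hp k, hw1 k⟩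
  rw [nhds_prod_eq, tendsto_prod_iff'] at hlim
  obtain ⟨hpa, hwx⟩ := hlim
  simp only [Function.comp_def] at hpa hwx
  obtain ⟨D, hD⟩ := hK.isBounded.exists_norm_le
  have hd : ∀ k, ‖y k - p k‖ ≤ D + D := fun k => (norm_sub_le _ _).trans
    (add_le_add (hD _ (hy k)) (hD _ (h.mem_of_mem_frontier (hp k))))
  have ht0 : Tendsto (fun k => 1 / ((φ k : ℝ) + 1)) atTop (𝓝 0) :=
    tendsto_one_div_add_atTop_nhds_zero_nat.comp hφ.tendsto_atTop
  set s : ℕ → ℝ := fun k => 1 / ((φ k : ℝ) + 1) * ‖y (φ k) - p (φ k)‖ with hs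
  have hs0 : ∀ k, 0 < s k := fun k => mul_pos (ht _) (hne _)
  have hslim : Tendsto s atTop (𝓝 0) :=
    squeeze_zero (fun k => (hs0 k).le)
      (fun k => mul_le_mul_of_nonneg_left (hd _) (ht _).le) (by simpa using ht0.mul_const (D + D))
  have hin : ∀ k, -s k * (1 / ((φ k : ℝ) + 1)) ≤ inner ℝ (gradient Ψ (p (φ k))) (w (φ k)) := by
    intro k
    have h1 := hlt (φ k)
    have h2 : inner ℝ (gradient Ψ (p (φ k))) (y (φ k) - p (φ k)) =
        ‖y (φ k) - p (φ k)‖ * inner ℝ (gradient Ψ (p (φ k))) (w (φ k)) := by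
      conv_lhs => rw [hyw, inner_smul_right]
    rw [h2] at h1
    have := hne (φ k)
    rw [hs]
    by_contra! hc
    have := mul_lt_mul_of_pos_left hc this
    nlinarith
  have hin' : ∀ k, inner ℝ (gradient Ψ (p (φ k))) (w (φ k)) ≤ 0 := fun k => by
    have := h.inner_gradient_nonpos hconv (hp (φ k)) (hy (φ k))
    rw [hw, inner_smul_right]
    exact mul_nonpos_of_nonneg_of_nonpos (by positivity) this
  have hx0 : inner ℝ (gradient Ψ a) x = 0 := by
    have hl := ((h.continuous_gradient.tendsto a).comp hpa).inner hwx (𝕜 := ℝ)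
    exact le_antisymm (le_of_tendsto' hl hin')
      (le_of_tendsto_of_tendsto' (by simpa using hslim.neg.mul ht0) hl hin)
  obtain ⟨q, hq, hqe⟩ := h.contDiff.exists_taylor_two_tendsto hpa hwx hslim
  have hxne : x ≠ 0 := ne_of_mem_sphere hx one_ne_zero
  have hgt := hpos a ha x ((h.mem_bodyTangentSpace_iff hconv ha).2 hx0) hxne
  have hle : ∀ k, q k ≤ 2 * (1 / ((φ k : ℝ) + 1)) := fun k => by
    have hmem : p (φ k) + s k • w (φ k) ∈ K := by
      rw [hs, mul_smul, ← hyw]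
      refine hconv.add_smul_sub_mem (h.mem_of_mem_frontier (hp _)) (hy _) ⟨(ht _).le, ?_⟩
      exact (div_le_one (by positivity)).2 (by simp)
    have h1 := h.mem_iff.1 hmem
    rw [hqe, h.apply_eq_zero (hp _), ← inner_gradient_eq_fderiv] at h1
    have h2 := mul_le_mul_of_nonneg_left (hin k) (hs0 k).le
    have h3 : 0 < s k ^ 2 := pow_pos (hs0 k) 2
    have h4 : s k ^ 2 * (q k - 2 * (1 / ((φ k : ℝ) + 1))) ≤ 0 := by linarith
    have := nonpos_of_mul_nonpos_right h4 h3
    linarith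
  exact absurd (le_of_tendsto_of_tendsto' hq (by simpa using ht0.const_mul 2) hle) (not_le.2 hgt)

theorem isBallLike (h : IsC2DefiningFunction K Ψ) (hK : IsCompact K) (hconv : Convex ℝ K)
    (hpos : HessianPosDefOnTangent K Ψ) : IsBallLike K := by
  obtain ⟨ε, hε, hinsc⟩ := h.exists_hasInscribedTangentBall hK
  obtain ⟨c, hc, hsep⟩ := h.exists_mul_norm_sq_le hK hconv hpos
  obtain ⟨M, hM⟩ := hK.exists_bound_of_continuousOn h.continuous_gradient.continuousOn
  have hL : 0 < max M 1 := zero_lt_one.trans_le (le_max_right _ _)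
  -- With this radius, `c` times the ball inequality follows from the separation bound and
  -- `‖gradient Ψ a‖ ≤ max M 1`.
  set R : ℝ := max M 1 / (2 * c) with hR
  have hR0 : 0 < R := by positivity
  refine ⟨h.isSmoothBody hconv, ε, hε, R, hR0, fun a ha => ⟨hinsc a ha, ?_⟩⟩
  have hg0 : 0 < ‖gradient Ψ a‖ := norm_pos_iff.2 (h.gradient_ne_zero a ha)
  set u := ‖gradient Ψ a‖⁻¹ • gradient Ψ a with hu
  have hu1 : ‖u‖ = 1 := by rw [hu, norm_smul, norm_inv, norm_norm, inv_mul_cancel₀ hg0.ne']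
  refine ⟨a - R • u, mem_frontier_closedBall_sub_smul hR0 hu1, fun y hy => ?_⟩
  rw [mem_closedBall_sub_smul_iff hR0 hu1]
  have hin : inner ℝ (gradient Ψ a) (y - a) = ‖gradient Ψ a‖ * inner ℝ u (y - a) := by
    rw [hu, inner_smul_left]
    simp [hg0.ne']
  have h1 := hsep a ha y hy
  rw [hin] at h1
  have hneg : inner ℝ u (y - a) ≤ 0 := by
    have := h.inner_gradient_nonpos hconv ha hy
    rw [hin] at this
    exact nonpos_of_mul_nonpos_right this hg0
  have h2 := mul_le_mul_of_nonpos_right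
    ((hM a (h.mem_of_mem_frontier ha)).trans (le_max_left M 1)) hneg
  have h3 : c * (‖y - a‖ ^ 2 + 2 * R * inner ℝ u (y - a)) ≤ 0 := by
    have : c * (‖y - a‖ ^ 2 + 2 * R * inner ℝ u (y - a)) =
        c * ‖y - a‖ ^ 2 + max M 1 * inner ℝ u (y - a) := by
      rw [hR]
      field_simp
    linarith
  exact nonpos_of_mul_nonpos_right h3 hc

/-- A circumscribed tangent ball forces the Hessian of every defining function to be positive
definite on the tangent space. -/
theorem hessianPosDefOnTangent (h : IsC2DefiningFunction K Ψ) (hconv : Convex ℝ K)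
    (hball : IsBallLike K) : HessianPosDefOnTangent K Ψ := by
  intro a ha x hx hx0
  obtain ⟨-, _, -, R, hR, hb⟩ := hball
  obtain ⟨c, hac, hKc⟩ := (hb a ha).2
  rw [frontier_closedBall _ hR.ne', mem_sphere, dist_eq_norm] at hac
  rw [h.mem_bodyTangentSpace_iff hconv ha] at hx
  have hsep : ∀ y ∈ K, ‖y - a‖ ^ 2 ≤ 2 * inner ℝ (c - a) (y - a) := fun y hy => by
    have h1 : ‖y - c‖ ^ 2 ≤ R ^ 2 := by
      have := hKc hy
      rw [mem_closedBall, dist_eq_norm] at this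
      gcongr
    rw [show y - c = (y - a) - (c - a) by abel, norm_sub_sq_real, norm_sub_rev c a, hac,
      real_inner_comm] at h1
    linarith
  -- The ball's centre lies along an inward normal, so `c - a = -(lam • g)`.
  obtain ⟨lam, hlam, hcl⟩ := h.exists_eq_smul_of_mem_normalCone ha (v := c - a) fun y hy => by
    have := hsep y hy
    have := sq_nonneg ‖y - a‖
    linarith
  set g := gradient Ψ a with hg
  have hg0 : 0 < ‖g‖ := norm_pos_iff.2 (h.gradient_ne_zero a ha)
  have hxn : 0 < ‖x‖ := norm_pos_iff.2 hx0
  by_contra! hH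
  -- The test curve is `a + t • x - (t ^ 2 * s) • g`. Any `s > 0` keeps it in `K` for small `t`, as
  -- the Hessian term is at most zero in the limit; a small `s` violates the ball bound `hsep`. The
  -- `+ 1` covers `lam = 0`.
  obtain ⟨s, hs, hsl⟩ : ∃ s > 0, 2 * lam * s * ‖g‖ ^ 2 < ‖x‖ ^ 2 := by
    refine ⟨‖x‖ ^ 2 / (2 * lam * ‖g‖ ^ 2 + 1), by positivity, ?_⟩
    rw [show 2 * lam * (‖x‖ ^ 2 / (2 * lam * ‖g‖ ^ 2 + 1)) * ‖g‖ ^ 2 =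
      ‖x‖ ^ 2 * (2 * lam * ‖g‖ ^ 2) / (2 * lam * ‖g‖ ^ 2 + 1) by ring,
      div_lt_iff₀ (by positivity)]
    nlinarith [pow_pos hxn 2]
  have htend : Tendsto (fun t : ℝ => t) (𝓝[>] 0) (𝓝 0) := nhdsWithin_le_nhds
  have hw : Tendsto (fun t : ℝ => x - (t * s) • g) (𝓝[>] 0) (𝓝 x) := by
    have : Continuous fun t : ℝ => x - (t * s) • g := by fun_prop
    simpa using (this.tendsto 0).mono_left nhdsWithin_le_nhds
  obtain ⟨q, hq, hqe⟩ := h.contDiff.exists_taylor_two_tendsto tendsto_const_nhds hw htend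
  obtain ⟨t, htq, ht⟩ := ((hq.eventually (gt_mem_nhds (hH.trans_lt
    (show 0 < 2 * s * ‖g‖ ^ 2 by positivity)))).and self_mem_nhdsWithin).exists
  replace ht : 0 < t := ht
  have hgw : inner ℝ g (x - (t * s) • g) = -(t * s * ‖g‖ ^ 2) := by
    rw [inner_sub_right, inner_smul_right, hx, real_inner_self_eq_norm_sq, zero_sub]
  have hmem : a + t • (x - (t * s) • g) ∈ K := by
    rw [h.mem_iff, hqe, h.apply_eq_zero ha, ← inner_gradient_eq_fderiv, ← hg, hgw]
    have := mul_le_mul_of_nonneg_left htq.le (sq_nonneg t)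
    linarith
  have h1 := hsep _ hmem
  rw [add_sub_cancel_left, hcl, inner_neg_left, inner_smul_left, inner_smul_right, hgw, norm_smul,
    mul_pow, norm_sub_sq_real, inner_smul_right, real_inner_comm, hx, Real.norm_of_nonneg ht.le] at h1
  simp only [conj_trivial] at h1
  have h2 : t ^ 2 * ‖x‖ ^ 2 ≤ t ^ 2 * (2 * lam * s * ‖g‖ ^ 2) := by
    have := mul_nonneg (sq_nonneg t) (sq_nonneg ‖(t * s) • g‖)
    linarith
  exact absurd (le_of_mul_le_mul_left h2 (pow_pos ht 2)) (not_le.2 hsl)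

end IsC2DefiningFunction

end Body

theorem mainTheorem11 {n : ℕ} (K : ConvexBody (EuclideanSpace ℝ (Fin n)))
    (hint : (interior (K : Set (EuclideanSpace ℝ (Fin n)))).Nonempty)
    (hC2 : HasC2Boundary (K : Set (EuclideanSpace ℝ (Fin n)))) :
    (IsBallLike (K : Set (EuclideanSpace ℝ (Fin n))) ↔
        IsTwoStrictlyConvex (K : Set (EuclideanSpace ℝ (Fin n)))) ∧
      ∀ Ψ : EuclideanSpace ℝ (Fin n) → ℝ,
        IsC2DefiningFunction (K : Set (EuclideanSpace ℝ (Fin n))) Ψ →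
          (IsTwoStrictlyConvex (K : Set (EuclideanSpace ℝ (Fin n))) ↔
            HessianPosDefOnTangent (K : Set (EuclideanSpace ℝ (Fin n))) Ψ) := by
  have hcomp : IsCompact (K : Set (EuclideanSpace ℝ (Fin n))) := K.isCompact
  have hconv : Convex ℝ (K : Set (EuclideanSpace ℝ (Fin n))) := K.convex
  have hback : IsTwoStrictlyConvex (K : Set (EuclideanSpace ℝ (Fin n))) →
      IsBallLike (K : Set (EuclideanSpace ℝ (Fin n))) := by
    rintro ⟨Ψ, hΨ, hpos⟩
    exact hΨ.isBallLike hcomp hconv hpos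
  obtain ⟨Ψ₀, hΨ₀⟩ := hC2
  exact ⟨⟨fun hb => ⟨Ψ₀, hΨ₀, hΨ₀.hessianPosDefOnTangent hconv hb⟩, hback⟩, fun Ψ hΨ =>
    ⟨fun h2 => hΨ.hessianPosDefOnTangent hconv (hback h2), fun hpos => ⟨Ψ, hΨ, hpos⟩⟩⟩
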